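/- Let $\Gamma$ be a subgroup of finite index of $\mathrm{SL}_2(\mathbb{Z})$, acting on the cusps $\mathbb{Q}\cup\{\infty\}$ by Möbius transformations, and write $\mathfrak{a}\sim\mathfrak{b}$ if $\mathfrak{b}=\gamma(\mathfrak{a})$ for some $\gamma\in\Gamma$. Let $\mathfrak{a}\in\mathbb{Q}\cup\{\infty\}$ and let $\tau\ge 2$ be a real number. Let $A_\tau^{\mathfrak{a}}$ be the set of all $x\in\mathbb{R}$ for which there is a constant $C$, which may depend on $x$, such that $$\left|x-\frac{p}{q}\right|\le \frac{C}{q^{\tau}}$$ for infinitely many rational numbers $p/q\sim\mathfrak{a}$, written in lowest terms with $q>0$. Then the Hausdorff dimension of $A_\tau^{\mathfrak{a}}$ is $2/\tau$. Moreover, $\mathcal{H}^{2/\tau}(A_\tau^{\mathfrak{a}})=\infty$, where $\mathcal{H}^t$ denotes the $t$-dimensional Hausdorff outer measure on $\mathbb{R}$. -/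

import Mathlib

open MeasureTheory
open scoped MatrixGroups ENNReal

/-- The action of an integer matrix of determinant one on the cusps, that is on the rational
projective line `ℚ ∪ {∞}`, by Möbius transformations `z ↦ (a z + b) / (c z + d)`. -/
noncomputable def moebius (γ : SL(2, ℤ)) (𝔞 : OnePoint ℚ) : OnePoint ℚ :=
  Matrix.SpecialLinearGroup.mapGL ℚ γ • 𝔞

/-- Two cusps are equivalent modulo `Γ` if some element of `Γ` maps the first to the second. -/
def CuspEquiv (Γ : Subgroup SL(2, ℤ)) (𝔞 𝔟 : OnePoint ℚ) : Prop :=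
  ∃ γ ∈ Γ, 𝔟 = moebius γ 𝔞

/-- The real numbers `x` for which there is a constant `C` (which may depend on `x`) such that
`|x - p / q| ≤ C / q ^ τ` for infinitely many rational numbers `p / q` (written in lowest terms,
with `q > 0`) that are equivalent to the cusp `𝔞` modulo `Γ`. -/
def approxSet (Γ : Subgroup SL(2, ℤ)) (𝔞 : OnePoint ℚ) (τ : ℝ) : Set ℝ :=
  {x : ℝ | ∃ C : ℝ, {r : ℚ | CuspEquiv Γ (r : OnePoint ℚ) 𝔞 ∧
    |x - (r : ℝ)| ≤ C / (r.den : ℝ) ^ τ}.Infinite}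

/-!
Every rational `r = g ∞` is close to a point of the orbit of `𝔞` of comparable denominator. By
finite index, `g h ∞` lies in the orbit for some `h` from a finite list that does not depend on `g`,
and `r` and `g h ∞` differ by the lower left entry of `h` over the product of their denominators.
Dirichlet's theorem therefore holds, up to a constant, with approximants taken from the orbit. The
Hausdorff–Cantelli lemma gives the upper bound for the dimension.

For the infinite measure, the balls of radius `ρ ^ s`, where `s = 2 / τ`, around the orbit cover
almost every point infinitely often, and the mass transference principle passes to the balls of
radius `ρ`. Suppose the limsup set in a ball of radius `r` had a cover of weight below `r ^ s`, the
weight being a multiple of `∑ diam ^ s`. Remove finitely many sets of the cover, so that those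
meeting the rest have negligible total weight, and pick there a disjoint Vitali family of balls of
radii `ρ ^ s`. A set of the cover meeting several of the concentric balls of radius `ρ` has diameter
comparable with the sum of their `ρ ^ s`; hence not all of these balls can carry weight at least
`ρ ^ s`. Iterating produces a point of the limsup set outside the cover. So the measure of the
limsup set in a ball of radius `r` is at least a multiple of `r ^ s`, and differentiation of
measures makes it infinite when `s < 1`.
-/

open Metric Filter Topology

/-- The limsup set of the balls `closedBall (c i) (ρ i)`: the points lying in balls of the family of
arbitrarily small radius. -/
def limsupBall {ι : Type*} (c ρ : ι → ℝ) : Set ℝ :=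
  {x | ∀ ε > 0, ∃ i, ρ i < ε ∧ x ∈ closedBall (c i) (ρ i)}

/-- The indices of the sets of the family `t` that meet `B`. -/
def meetIndices {X κ : Type*} (t : κ → Set X) (B : Set X) : Set κ :=
  {n | (t n ∩ B).Nonempty}

/-- The total weight, with respect to `w`, of the sets of the family `t` that meet `B`. -/
noncomputable def meetWeight {X κ : Type*} (t : κ → Set X) (w : κ → ℝ≥0∞) (B : Set X) : ℝ≥0∞ :=
  ∑' n, (meetIndices t B).indicator w n

section Cover

variable {X : Type*} [EMetricSpace X] [MeasurableSpace X] [BorelSpace X]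

lemma exists_cover_tsum_lt {s : ℝ} (hs : 0 < s) {A : Set X} {m : ℝ≥0∞} (hA : 4 * μH[s] A < m) :
    ∃ (t : ℕ → Set X) (w : ℕ → ℝ≥0∞), A ⊆ ⋃ n, t n ∧ (∀ n, ediam (t n) ≤ 1) ∧ (∀ n, 0 < w n) ∧
      (∀ n, 4 * ediam (t n) ^ s ≤ w n) ∧ ∑' n, w n < m := by
  obtain ⟨δ, hδ, hAδ⟩ := ENNReal.lt_iff_exists_add_pos_lt.1 hA
  have hlt : μH[s] A < (m - δ) / 4 := by
    rw [ENNReal.lt_div_iff_mul_lt (by simp) (by simp), mul_comm]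
    exact lt_tsub_iff_right.2 hAδ
  rw [Measure.hausdorffMeasure_apply] at hlt
  have h1 := (le_iSup₂ (f := fun (r : ℝ≥0∞) (_ : 0 < r) =>
    ⨅ (t : ℕ → Set X) (_ : A ⊆ ⋃ n, t n) (_ : ∀ n, ediam (t n) ≤ r),
      ∑' n, ⨆ _ : (t n).Nonempty, ediam (t n) ^ s) 1 one_pos).trans_lt hlt
  simp only [iInf_lt_iff] at h1
  obtain ⟨t, hAt, ht, hsum⟩ := h1
  obtain ⟨η, hη, hηsum⟩ := ENNReal.exists_pos_sum_of_countable
    (ENNReal.coe_pos.2 hδ).ne' ℕ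
  have hdiam : ∀ n, ⨆ _ : (t n).Nonempty, ediam (t n) ^ s = ediam (t n) ^ s := by
    intro n
    rcases (t n).eq_empty_or_nonempty with h | h
    · simp [h, hs]
    · simp [h]
  simp only [hdiam] at hsum
  refine ⟨t, fun n => 4 * ediam (t n) ^ s + η n, hAt, ht, fun n => ?_, fun n => le_self_add, ?_⟩
  · exact (ENNReal.coe_pos.2 (hη n)).trans_le le_add_self
  · rw [ENNReal.tsum_add, ENNReal.tsum_mul_left]
    rw [ENNReal.lt_div_iff_mul_lt (by simp) (by simp), mul_comm] at hsum
    exact (ENNReal.add_lt_add hsum hηsum).trans_le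
      (tsub_add_cancel_of_le (le_add_self.trans hAδ.le)).le

end Cover

lemma sum_le_tsum_indicator_biUnion {ι κ : Type*} {F : Finset ι} {a : ι → ℝ≥0∞} {w : κ → ℝ≥0∞}
    {N : ι → Set κ} (hN : ∀ i ∈ F, a i ≤ ∑' n, (N i).indicator w n)
    (hw : ∀ n, ∀ S ⊆ F, S.Nontrivial → (∀ i ∈ S, n ∈ N i) → ∑ i ∈ S, a i ≤ w n) :
    ∑ i ∈ F, a i ≤ ∑' n, (⋃ i ∈ F, N i).indicator w n := by
  classical
  have hmin : ∀ i ∈ F, a i ≤ ∑' n, (N i).indicator (fun n => min (a i) (w n)) n := by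
    intro i hi
    by_cases h : ∃ n ∈ N i, a i ≤ w n
    · obtain ⟨n, hn, han⟩ := h
      refine le_trans ?_ (ENNReal.le_tsum n)
      simp [hn, han]
    · push Not at h
      refine (hN i hi).trans (ENNReal.tsum_le_tsum fun n => ?_)
      by_cases hn : n ∈ N i
      · simp [hn, (h n hn).le]
      · simp [hn]
  have hpoint : ∀ n, ∑ i ∈ F, (N i).indicator (fun n => min (a i) (w n)) n ≤
      (⋃ i ∈ F, N i).indicator w n := by
    intro n
    simp only [Set.indicator_apply, ← Finset.sum_filter]
    rcases (F.filter (n ∈ N ·)).eq_empty_or_nonempty with h | h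
    · simp [h]
    have hn : n ∈ ⋃ i ∈ F, N i := by
      obtain ⟨i, hi⟩ := h
      rw [Finset.mem_filter] at hi
      exact Set.mem_biUnion hi.1 hi.2
    rw [if_pos hn]
    rcases h.exists_eq_singleton_or_nontrivial with ⟨i, hi⟩ | h
    · simp [hi]
    · exact (Finset.sum_le_sum fun i _ => min_le_left _ _).trans
        (hw n _ (Finset.filter_subset _ _) h fun i hi => (Finset.mem_filter.1 hi).2)
  calc ∑ i ∈ F, a i ≤ ∑ i ∈ F, ∑' n, (N i).indicator (fun n => min (a i) (w n)) n :=
        Finset.sum_le_sum hmin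
    _ = ∑' n, ∑ i ∈ F, (N i).indicator (fun n => min (a i) (w n)) n :=
        (Summable.tsum_finsetSum fun _ _ => ENNReal.summable).symm
    _ ≤ ∑' n, (⋃ i ∈ F, N i).indicator w n := ENNReal.tsum_le_tsum hpoint

section VitaliLayer

variable {ι : Type*} {c v : ι → ℝ}

lemma exists_disjoint_closedBall_subset (hv : ∀ i, 0 < v i) (hlim : ∀ᵐ x, x ∈ limsupBall c v)
    {G : Set ℝ} (hG : IsOpen G) {m : ℝ≥0∞} (hm : m < volume G) {ε : ℝ} (hε : 0 < ε) :
    ∃ T : Finset ι, (∀ i ∈ T, v i < ε ∧ closedBall (c i) (v i) ⊆ G) ∧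
      (T : Set ι).PairwiseDisjoint (fun i => closedBall (c i) (v i)) ∧
      m < ∑ i ∈ T, ENNReal.ofReal (10 * v i) := by
  obtain ⟨u, hut, hud, hcover⟩ := Vitali.exists_disjoint_subfamily_covering_enlargement_closedBall
    {i | v i < ε ∧ closedBall (c i) (v i) ⊆ G} c v ε (fun i hi => hi.1.le) 5 (by norm_num)
  have hucount : u.Countable := hud.countable_of_nonempty_interior fun i _ =>
    ⟨c i, ball_subset_interior_closedBall (mem_ball_self (hv i))⟩
  have hGu : G ≤ᵐ[volume] ⋃ i ∈ u, closedBall (c i) (5 * v i) := by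
    filter_upwards [hlim] with x hx hxG
    obtain ⟨η, hη, hball⟩ := Metric.isOpen_iff.1 hG x hxG
    obtain ⟨i, hi, hxi⟩ := hx (min ε (η / 2)) (by positivity)
    have hiG : closedBall (c i) (v i) ⊆ G := by
      refine fun y hy => hball ?_
      have htri := dist_triangle_right y x (c i)
      have hiη := hi.trans_le (min_le_right _ _)
      rw [mem_closedBall] at hy hxi
      rw [mem_ball]
      linarith
    obtain ⟨j, hj, hsub⟩ := hcover i ⟨hi.trans_le (min_le_left _ _), hiG⟩
    exact Set.mem_biUnion hj (hsub hxi)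
  have hvol : m < ∑' i : u, ENNReal.ofReal (10 * v i) := by
    refine hm.trans_le ((measure_mono_ae hGu).trans ((measure_biUnion_le _ hucount _).trans_eq ?_))
    simp only [Real.volume_closedBall, ← mul_assoc]
    norm_num
  obtain ⟨S, hS⟩ := lt_iSup_iff.1 (ENNReal.tsum_eq_iSup_sum.subst hvol)
  refine ⟨S.map (Function.Embedding.subtype _), fun i hi => ?_, ?_, by simpa using hS⟩
  · obtain ⟨j, -, rfl⟩ := Finset.mem_map.1 hi
    exact hut j.2
  · exact hud.subset (by simp)

variable {ρ : ι → ℝ} {T : Finset ι}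

lemma sum_radius_le {y R : ℝ} (hv : ∀ i ∈ T, 0 ≤ v i) (hR : 0 ≤ R)
    (hd : (T : Set ι).PairwiseDisjoint fun i => closedBall (c i) (v i))
    (hsub : ∀ i ∈ T, closedBall (c i) (v i) ⊆ closedBall y R) : ∑ i ∈ T, v i ≤ R := by
  have hvol : volume (⋃ i ∈ T, closedBall (c i) (v i)) ≤ volume (closedBall y R) :=
    measure_mono (Set.iUnion₂_subset hsub)
  rw [measure_biUnion_finset hd fun _ _ => measurableSet_closedBall] at hvol
  simp only [Real.volume_closedBall] at hvol
  rw [← ENNReal.ofReal_sum_of_nonneg fun i hi => mul_nonneg zero_le_two (hv i hi),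
    ENNReal.ofReal_le_ofReal_iff (by positivity), ← Finset.mul_sum] at hvol
  linarith

lemma sum_radius_le_ediam (hv : ∀ i ∈ T, 0 ≤ v i) (hρv : ∀ i ∈ T, ρ i ≤ v i / 2)
    (hd : (T : Set ι).PairwiseDisjoint fun i => closedBall (c i) (v i)) (hT : T.Nontrivial)
    {U : Set ℝ} (hU : ∀ i ∈ T, (U ∩ ball (c i) (ρ i)).Nonempty) :
    ∑ i ∈ T, ENNReal.ofReal (v i) ≤ 4 * ediam U := by
  rcases eq_or_ne (ediam U) ∞ with htop | htop
  · simp [htop]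
  choose! y hyU hy using hU
  have hyd : ∀ i ∈ T, ∀ j ∈ T, dist (y i) (y j) ≤ diam U := fun i hi j hj =>
    dist_le_diam_of_mem' htop (hyU i hi) (hyU j hj)
  have hdiam : ∀ i ∈ T, v i / 2 ≤ diam U := by
    intro i hi
    obtain ⟨j, hj, hji⟩ := hT.exists_ne i
    have hij := (disjoint_closedBall_closedBall_iff (hv i hi) (hv j hj)).1 (hd hi hj hji.symm)
    have htri := dist_triangle4 (c i) (y i) (y j) (c j)
    rw [dist_comm (c i) (y i)] at htri
    linarith [mem_ball.1 (hy i hi), mem_ball.1 (hy j hj), hρv i hi, hρv j hj,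
      hyd i hi j hj, hv j hj]
  obtain ⟨i₀, hi₀⟩ := hT.nonempty
  have hsum : ∑ i ∈ T, v i ≤ 4 * diam U := by
    refine sum_radius_le (y := y i₀) hv (by positivity) hd fun i hi z hz => ?_
    have htri := dist_triangle4 z (c i) (y i) (y i₀)
    rw [dist_comm (c i) (y i)] at htri
    rw [mem_closedBall] at hz ⊢
    linarith [mem_ball.1 (hy i hi), hdiam i hi, hρv i hi, hyd i hi i₀ hi₀]
  calc ∑ i ∈ T, ENNReal.ofReal (v i) = ENNReal.ofReal (∑ i ∈ T, v i) :=
        (ENNReal.ofReal_sum_of_nonneg hv).symm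
    _ ≤ ENNReal.ofReal (4 * diam U) := ENNReal.ofReal_le_ofReal hsum
    _ = 4 * ediam U := by
        rw [ENNReal.ofReal_mul zero_le_four, diam, ENNReal.ofReal_toReal htop]
        norm_num

end VitaliLayer

section MassTransference

variable {ι : Type*} {c ρ : ι → ℝ} {s : ℝ} {t : ℕ → Set ℝ} {w : ℕ → ℝ≥0∞}

lemma le_meetWeight {X κ : Type*} {t : κ → Set X} {w : κ → ℝ≥0∞} {B : Set X} {n : κ}
    (hn : n ∈ meetIndices t B) : w n ≤ meetWeight t w B := by
  refine le_trans ?_ (ENNReal.le_tsum n)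
  rw [Set.indicator_of_mem hn]

lemma meetWeight_ediam_le (hs : 0 < s) (hs1 : s ≤ 1) (hw : ∀ n, ediam (t n) ^ s ≤ w n)
    {B : Set ℝ} {r : ℝ≥0∞} (hB : meetWeight t w B ≤ r ^ s) :
    meetWeight t (fun n => ediam (t n)) B ≤ r := by
  have hsplit : ∀ a : ℝ≥0∞, a ^ (1 - s) * a ^ s = a := fun a => by
    rw [← ENNReal.rpow_add_of_nonneg _ _ (by linarith) hs.le, sub_add_cancel, ENNReal.rpow_one]
  have hpow : ∀ n ∈ meetIndices t B, ediam (t n) ≤ r ^ (1 - s) * w n := by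
    intro n hn
    have hle : ediam (t n) ≤ r :=
      (ENNReal.rpow_le_rpow_iff hs).1 ((hw n).trans ((le_meetWeight hn).trans hB))
    calc ediam (t n) = ediam (t n) ^ (1 - s) * ediam (t n) ^ s := (hsplit _).symm
      _ ≤ r ^ (1 - s) * w n :=
        mul_le_mul' (ENNReal.rpow_le_rpow hle (by linarith)) (hw n)
  calc meetWeight t (fun n => ediam (t n)) B
      ≤ ∑' n, r ^ (1 - s) * (meetIndices t B).indicator w n := by
        refine ENNReal.tsum_le_tsum fun n => ?_
        by_cases hn : n ∈ meetIndices t B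
        · simpa [hn] using hpow n hn
        · simp [hn]
    _ = r ^ (1 - s) * meetWeight t w B := ENNReal.tsum_mul_left
    _ ≤ r ^ (1 - s) * r ^ s := mul_le_mul_right hB _
    _ = r := hsplit r

lemma volume_inter_closure_le {G : Set ℝ} (hG : IsOpen G) (n : ℕ) :
    volume (G ∩ closure (t n)) ≤ (meetIndices t G).indicator (fun n => ediam (t n)) n := by
  by_cases hn : n ∈ meetIndices t G
  · rw [Set.indicator_of_mem hn, ← ediam_closure]
    exact (measure_mono Set.inter_subset_right).trans (Real.volume_le_diam _)
  · have hdisj : Disjoint G (t n) := by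
      rw [disjoint_comm, Set.disjoint_iff_inter_eq_empty]
      exact Set.not_nonempty_iff_eq_empty.1 hn
    rw [(hdisj.closure_right hG).inter_eq, measure_empty]
    exact zero_le

lemma volume_sub_meetWeight_le {G : Set ℝ} (hG : IsOpen G) (S : Finset ℕ) :
    volume G - meetWeight t (fun n => ediam (t n)) G ≤ volume (G \ ⋃ n ∈ S, closure (t n)) := by
  have hcov : volume (G ∩ ⋃ n ∈ S, closure (t n)) ≤ meetWeight t (fun n => ediam (t n)) G := by
    rw [Set.inter_iUnion₂]
    exact (measure_biUnion_finset_le _ _).trans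
      ((Finset.sum_le_sum fun n _ => volume_inter_closure_le hG n).trans (ENNReal.sum_le_tsum S))
  rw [← Set.sdiff_self_inter]
  exact (tsub_le_tsub_left hcov _).trans le_measure_sdiff

lemma exists_isOpen_subset_meetWeight_lt {B : Set ℝ} (hB : IsOpen B)
    (hfin : meetWeight t w B ≠ ∞) {δ : ℝ≥0∞} (hδ : 0 < δ) :
    ∃ G ⊆ B, IsOpen G ∧ volume B - meetWeight t (fun n => ediam (t n)) B ≤ volume G ∧
      meetWeight t w G < δ := by
  obtain ⟨S, hS⟩ := ((ENNReal.tendsto_tsum_compl_atTop_zero hfin).eventually_lt_const hδ).exists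
  refine ⟨B \ ⋃ n ∈ S, closure (t n), Set.sdiff_subset,
    hB.sdiff (S.finite_toSet.isClosed_biUnion fun _ _ => isClosed_closure),
    volume_sub_meetWeight_le hB S, lt_of_le_of_lt ?_ hS⟩
  refine le_of_le_of_eq ?_ (tsum_subtype {n | n ∉ S} ((meetIndices t B).indicator w)).symm
  rw [Set.indicator_indicator]
  refine ENNReal.tsum_le_tsum
    (Set.indicator_le_indicator_of_subset ?_ fun _ => zero_le)
  rintro n ⟨y, hyn, hyB, hyS⟩
  exact ⟨fun hn => hyS (Set.mem_biUnion hn (subset_closure hyn)), y, hyn, hyB⟩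

lemma sum_radius_le_meetWeight {v : ι → ℝ} {T : Finset ι} {G : Set ℝ} (hv : ∀ i ∈ T, 0 ≤ v i)
    (hρv : ∀ i ∈ T, ρ i ≤ v i / 2) (hw : ∀ n, 4 * ediam (t n) ≤ w n)
    (hd : (T : Set ι).PairwiseDisjoint fun i => closedBall (c i) (v i))
    (hG : ∀ i ∈ T, ball (c i) (ρ i) ⊆ G)
    (hT : ∀ i ∈ T, ENNReal.ofReal (v i) ≤ meetWeight t w (ball (c i) (ρ i))) :
    ∑ i ∈ T, ENNReal.ofReal (v i) ≤ meetWeight t w G := by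
  refine (sum_le_tsum_indicator_biUnion hT fun n S hST hS hn => ?_).trans
    (ENNReal.tsum_le_tsum fun n => Set.indicator_le_indicator_of_subset
      (Set.iUnion₂_subset fun i hi m hm => ?_) (fun _ => zero_le) n)
  · exact (sum_radius_le_ediam (fun i hi => hv i (hST hi)) (fun i hi => hρv i (hST hi))
      (hd.subset hST) hS hn).trans (hw n)
  · exact Set.Nonempty.mono (Set.inter_subset_inter_right _ (hG i hi)) hm

lemma exists_forall_rpow_lt_imp_le_half (hs : 0 < s) (hs1 : s < 1) {ε : ℝ} (hε : 0 < ε) :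
    ∃ δ > 0, ∀ a > 0, a ^ s < δ → a < ε ∧ a ≤ a ^ s / 2 := by
  refine ⟨min ε ((1 / 2) ^ (1 - s)⁻¹) ^ s, by positivity, fun a ha haδ => ?_⟩
  rw [Real.rpow_lt_rpow_iff ha.le (by positivity) hs, lt_min_iff] at haδ
  refine ⟨haδ.1, ?_⟩
  have hhalf : a ^ (1 - s) < 1 / 2 :=
    (Real.lt_rpow_inv_iff_of_pos ha.le (by norm_num) (by linarith)).1 haδ.2
  calc a = a ^ s * a ^ (1 - s) := by rw [← Real.rpow_add ha, add_sub_cancel, Real.rpow_one]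
    _ ≤ a ^ s * (1 / 2) := by gcongr
    _ = a ^ s / 2 := by ring

lemma exists_meetWeight_ball_lt (hρ : ∀ i, 0 < ρ i) (hs : 0 < s) (hs1 : s < 1)
    (hlim : ∀ᵐ x, x ∈ limsupBall c fun i => ρ i ^ s) (ht : ∀ n, ediam (t n) ≤ 1)
    (hw : ∀ n, 4 * ediam (t n) ^ s ≤ w n) {x r : ℝ} (hr : 0 < r)
    (hB : meetWeight t w (ball x r) < ENNReal.ofReal (r ^ s)) {ε : ℝ} (hε : 0 < ε) :
    ∃ i, ρ i < ε ∧ closedBall (c i) (ρ i) ⊆ ball x r ∧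
      meetWeight t w (ball (c i) (ρ i)) < ENNReal.ofReal (ρ i ^ s) := by
  have hdiam : meetWeight t (fun n => ediam (t n)) (ball x r) ≤ ENNReal.ofReal r :=
    meetWeight_ediam_le hs hs1.le (fun n => (le_mul_of_one_le_left' (by norm_num)).trans (hw n))
      (hB.le.trans_eq (ENNReal.ofReal_rpow_of_pos hr).symm)
  obtain ⟨G, hGB, hG, hvol, hGw⟩ := exists_isOpen_subset_meetWeight_lt isOpen_ball hB.ne_top
    (δ := ENNReal.ofReal (r / 20)) (by simpa)
  have hvolG : ENNReal.ofReal (r / 2) < volume G := by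
    refine lt_of_lt_of_le ?_ ((tsub_le_tsub_left hdiam _).trans hvol)
    rw [Real.volume_ball, ← ENNReal.ofReal_sub _ hr.le, ENNReal.ofReal_lt_ofReal_iff] <;> linarith
  have hdiam_le : ∀ n, 4 * ediam (t n) ≤ w n := fun n =>
    (mul_le_mul_right (by simpa using ENNReal.rpow_le_rpow_of_exponent_ge (ht n) hs1.le) _).trans
      (hw n)
  obtain ⟨δ, hδ, hsmall⟩ := exists_forall_rpow_lt_imp_le_half hs hs1 hε
  obtain ⟨T, hT, hTd, hTsum⟩ := exists_disjoint_closedBall_subset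
    (fun i => Real.rpow_pos_of_pos (hρ i) s) hlim hG hvolG hδ
  have hTε : ∀ i ∈ T, ρ i < ε ∧ ρ i ≤ ρ i ^ s / 2 := fun i hi => hsmall _ (hρ i) (hT i hi).1
  have hsub : ∀ i ∈ T, closedBall (c i) (ρ i) ⊆ G := fun i hi =>
    (closedBall_subset_closedBall (by linarith [hTε i hi, hρ i])).trans (hT i hi).2
  by_contra! hcon
  have hle := sum_radius_le_meetWeight (t := t) (w := w) (v := fun i => ρ i ^ s)
    (fun i _ => (Real.rpow_pos_of_pos (hρ i) s).le) (fun i hi => (hTε i hi).2)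
    hdiam_le hTd
    (fun i hi => ball_subset_closedBall.trans (hsub i hi))
    fun i hi => hcon i (hTε i hi).1 ((hsub i hi).trans hGB)
  simp only [ENNReal.ofReal_mul (show (0 : ℝ) ≤ 10 by norm_num), ← Finset.mul_sum] at hTsum
  refine absurd (hTsum.trans_le (mul_le_mul_right (hle.trans hGw.le) _)) ?_
  rw [← ENNReal.ofReal_mul (by norm_num), not_lt]
  exact ENNReal.ofReal_le_ofReal (by linarith)

lemma exists_mem_ball_of_nested {X : Type*} [MetricSpace X] [ProperSpace X] {c : ι → X}
    {P : ι → Prop} (hρ : ∀ i, 0 ≤ ρ i) (hnext : ∀ i, P i → ∀ ε > 0,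
      ∃ j, ρ j < ε ∧ closedBall (c j) (ρ j) ⊆ ball (c i) (ρ i) ∧ P j) {i₀ : ι} (hi₀ : P i₀) :
    ∃ y ∈ ball (c i₀) (ρ i₀), ∀ ε > 0, ∃ i, P i ∧ ρ i < ε ∧ y ∈ ball (c i) (ρ i) := by
  choose next hradius hsub hP using fun (i : {i // P i}) (k : ℕ) =>
    hnext i i.2 (1 / ((k : ℝ) + 1)) (by positivity)
  let b : ℕ → {i // P i} := fun k => Nat.rec ⟨i₀, hi₀⟩ (fun k i => ⟨next i k, hP i k⟩) k
  let K : ℕ → Set X := fun k => closedBall (c (b (k + 1)).1) (ρ (b (k + 1)).1)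
  have hK : ∀ k, K k ⊆ ball (c (b k).1) (ρ (b k).1) := fun k => hsub (b k) k
  obtain ⟨y, hy⟩ := IsCompact.nonempty_iInter_of_sequence_nonempty_isCompact_isClosed K
    (fun k => (hK (k + 1)).trans ball_subset_closedBall)
    (fun k => nonempty_closedBall.2 (hρ _)) (isCompact_closedBall _ _) fun _ => isClosed_closedBall
  have hyb : ∀ k, y ∈ ball (c (b k).1) (ρ (b k).1) := fun k => hK k (Set.mem_iInter.1 hy k)
  refine ⟨y, hyb 0, fun ε hε => ?_⟩
  obtain ⟨k, hk⟩ := exists_nat_one_div_lt hε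
  exact ⟨b (k + 1), (b (k + 1)).2, (hradius (b k) k).trans hk, hyb (k + 1)⟩

lemma exists_mem_limsupBall_notMem_iUnion (hρ : ∀ i, 0 < ρ i) (hs : 0 < s) (hs1 : s < 1)
    (hlim : ∀ᵐ x, x ∈ limsupBall c fun i => ρ i ^ s) (ht : ∀ n, ediam (t n) ≤ 1)
    (hw : ∀ n, 4 * ediam (t n) ^ s ≤ w n) (hw0 : ∀ n, 0 < w n) {x r : ℝ} (hr : 0 < r)
    (hB : meetWeight t w (ball x r) < ENNReal.ofReal (r ^ s)) :
    ∃ y ∈ limsupBall c ρ ∩ ball x r, y ∉ ⋃ n, t n := by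
  have step : ∀ {x r : ℝ}, 0 < r → meetWeight t w (ball x r) < ENNReal.ofReal (r ^ s) →
      ∀ ε > 0, ∃ i, ρ i < ε ∧ closedBall (c i) (ρ i) ⊆ ball x r ∧
        meetWeight t w (ball (c i) (ρ i)) < ENNReal.ofReal (ρ i ^ s) := fun hr hB _ hε =>
    exists_meetWeight_ball_lt hρ hs hs1 hlim ht hw hr hB hε
  obtain ⟨i₀, -, hi₀, hPi₀⟩ := step hr hB 1 one_pos
  obtain ⟨y, hy₀, hy⟩ := exists_mem_ball_of_nested
    (P := fun i => meetWeight t w (ball (c i) (ρ i)) < ENNReal.ofReal (ρ i ^ s))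
    (fun i => (hρ i).le) (fun i hi => step (hρ i) hi) hPi₀
  refine ⟨y, ⟨fun ε hε => ?_, hi₀ (ball_subset_closedBall hy₀)⟩, fun hyt => ?_⟩
  · obtain ⟨i, -, hiε, hyi⟩ := hy ε hε
    exact ⟨i, hiε, ball_subset_closedBall hyi⟩
  · obtain ⟨n, hn⟩ := Set.mem_iUnion.1 hyt
    have hzero : Tendsto (fun a : ℝ => ENNReal.ofReal (a ^ s)) (𝓝 0) (𝓝 0) :=
      (ENNReal.continuous_ofReal.comp (Real.continuous_rpow_const hs.le)).tendsto' 0 0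
        (by simp [hs.ne'])
    obtain ⟨ε, hε, hsmall⟩ :=
      Metric.eventually_nhds_iff.1 (hzero.eventually_lt_const (hw0 n))
    obtain ⟨i, hPi, hiε, hyi⟩ := hy ε hε
    have hlt : ENNReal.ofReal (ρ i ^ s) < w n := hsmall (by simpa [abs_of_pos (hρ i)] using hiε)
    exact ((le_meetWeight ⟨y, hn, hyi⟩).trans_lt (hPi.trans hlt)).false

lemma ofReal_rpow_le_hausdorffMeasure_limsupBall (hρ : ∀ i, 0 < ρ i) (hs : 0 < s) (hs1 : s < 1)
    (hlim : ∀ᵐ x, x ∈ limsupBall c fun i => ρ i ^ s) (x : ℝ) {r : ℝ} (hr : 0 < r) :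
    ENNReal.ofReal (r ^ s) ≤ 4 * μH[s] (limsupBall c ρ ∩ ball x r) := by
  by_contra! hlt
  obtain ⟨t, w, hcover, ht, hw0, hw, hsum⟩ := exists_cover_tsum_lt hs hlt
  have hB : meetWeight t w (ball x r) < ENNReal.ofReal (r ^ s) :=
    (ENNReal.tsum_le_tsum fun n => Set.indicator_le_self _ _ n).trans_lt hsum
  obtain ⟨y, hy, hyt⟩ := exists_mem_limsupBall_notMem_iUnion hρ hs hs1 hlim ht hw hw0 hr hB
  exact hyt (hcover hy)

lemma hausdorffMeasure_limsupBall_inter_eq_top (hρ : ∀ i, 0 < ρ i) (hs : 0 < s) (hs1 : s < 1)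
    (hlim : ∀ᵐ x, x ∈ limsupBall c fun i => ρ i ^ s) {U : Set ℝ} (hU : IsOpen U)
    (hne : U.Nonempty) : μH[s] (limsupBall c ρ ∩ U) = ∞ := by
  by_contra hfin
  let ν := (μH[s] : Measure ℝ).restrict (limsupBall c ρ ∩ U)
  have : IsFiniteMeasure ν := ⟨by simpa [ν] using lt_top_iff_ne_top.2 hfin⟩
  have hUpos : ∃ᵐ x, x ∈ U := frequently_ae_iff.2 (hU.measure_pos volume hne).ne'
  obtain ⟨x, hxU, hdensity, hlt⟩ := (hUpos.and_eventually
    ((Besicovitch.ae_tendsto_rnDeriv ν volume).and (ν.rnDeriv_lt_top volume))).exists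
  have hlarge : ∀ᶠ r : ℝ in 𝓝[>] 0,
      ENNReal.ofReal (r ^ (s - 1) / 8) ≤ ν (closedBall x r) / volume (closedBall x r) := by
    have hball : ∀ᶠ r in 𝓝[>] (0 : ℝ), ball x r ⊆ U :=
      (eventually_ball_subset (hU.mem_nhds hxU)).filter_mono nhdsWithin_le_nhds
    filter_upwards [hball, self_mem_nhdsWithin] with r hrU hr
    have hr : 0 < r := hr
    rw [Real.volume_closedBall, ENNReal.le_div_iff_mul_le (by simp [hr]) (by simp),
      ← ENNReal.ofReal_mul (by positivity)]
    calc ENNReal.ofReal (r ^ (s - 1) / 8 * (2 * r)) = ENNReal.ofReal (r ^ s) / 4 := by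
          rw [Real.rpow_sub_one hr.ne', ← ENNReal.ofReal_ofNat 4,
            ← ENNReal.ofReal_div_of_pos four_pos]
          congr 1
          field_simp
          norm_num
      _ ≤ μH[s] (limsupBall c ρ ∩ ball x r) := ENNReal.div_le_of_le_mul'
          (ofReal_rpow_le_hausdorffMeasure_limsupBall hρ hs hs1 hlim x hr)
      _ ≤ ν (closedBall x r) := by
          rw [Measure.restrict_apply measurableSet_closedBall]
          exact measure_mono fun y hy => ⟨ball_subset_closedBall hy.2, hy.1, hrU hy.2⟩
  have htop : Tendsto (fun r : ℝ => ENNReal.ofReal (r ^ (s - 1) / 8)) (𝓝[>] 0) (𝓝 ∞) :=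
    ENNReal.tendsto_ofReal_atTop.comp
      ((tendsto_rpow_neg_nhdsGT_zero (by linarith)).atTop_div_const (by norm_num))
  exact hlt.ne (tendsto_nhds_unique hdensity (tendsto_nhds_top_mono htop hlarge))

/-- The **mass transference principle** of Beresnevich and Velani on the real line. -/
theorem hausdorffMeasure_limsupBall_inter (hρ : ∀ i, 0 < ρ i) (hs : 0 < s) (hs1 : s ≤ 1)
    (hlim : ∀ᵐ x, x ∈ limsupBall c fun i => ρ i ^ s) {U : Set ℝ} (hU : IsOpen U) :
    μH[s] (limsupBall c ρ ∩ U) = μH[s] U := by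
  rcases U.eq_empty_or_nonempty with rfl | hne
  · simp
  rcases hs1.eq_or_lt with rfl | hs1
  · simp only [Real.rpow_one] at hlim
    rw [hausdorffMeasure_real]
    refine measure_congr ?_
    filter_upwards [hlim] with x hx
    exact propext (and_iff_right hx)
  · have htop := hausdorffMeasure_limsupBall_inter_eq_top hρ hs hs1 hlim hU hne
    exact htop.trans (top_unique (htop.symm.trans_le (measure_mono Set.inter_subset_right))).symm

end MassTransference

section HausdorffCantelli

variable {X : Type*} [EMetricSpace X] [MeasurableSpace X] [BorelSpace X]

/-- The **Hausdorff–Cantelli lemma**. -/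
lemma hausdorffMeasure_setOf_infinite_mem_eq_zero {ι : Type*} [Countable ι] {E : ι → Set X}
    {s : ℝ} (hs : 0 < s) (hE : ∑' i, ediam (E i) ^ s ≠ ∞) :
    μH[s] {x | {i | x ∈ E i}.Infinite} = 0 := by
  have htail : Tendsto (fun S : Finset ι => ∑' i : {i // i ∉ S}, ediam (E i) ^ s) atTop (𝓝 0) :=
    ENNReal.tendsto_tsum_compl_atTop_zero hE
  refine le_antisymm ((Measure.hausdorffMeasure_le_liminf_tsum s _
    (fun S : Finset ι => (∑' i : {i // i ∉ S}, ediam (E i) ^ s) ^ s⁻¹) ?_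
    (fun S (i : {i // i ∉ S}) => E i) (.of_forall fun S i => ?_)
    (.of_forall fun S x hx => ?_)).trans_eq htail.liminf_eq) zero_le
  · have hroot := (ENNReal.continuous_rpow_const (y := s⁻¹)).tendsto 0
    rw [ENNReal.zero_rpow_of_pos (inv_pos.2 hs)] at hroot
    exact hroot.comp htail
  · rw [ENNReal.le_rpow_inv_iff hs]
    exact ENNReal.le_tsum (f := fun i : {i // i ∉ S} => ediam (E i) ^ s) i
  · obtain ⟨i, hi, hiS⟩ := hx.exists_notMem_finset S
    exact Set.mem_iUnion.2 ⟨⟨i, hiS⟩, hi⟩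

end HausdorffCantelli

section Approximation

lemma summable_den_rpow_neg (B : ℝ) {a : ℝ} (ha : 2 < a) :
    Summable fun r : {r : ℚ // |(r : ℝ)| ≤ B} => (r.1.den : ℝ) ^ (-a) := by
  let f : {r : ℚ // |(r : ℝ)| ≤ B} → Fin 2 → ℤ := fun r => ![r.1.num, r.1.den]
  have hf : Function.Injective f := fun r r' h => Subtype.ext <|
    Rat.ext (congrFun h 0) (Nat.cast_injective (congrFun h 1 : (r.1.den : ℤ) = r'.1.den))
  have hsum := ((EisensteinSeries.summable_one_div_norm_rpow ha).comp_injective hf).mul_left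
    (max B 1 ^ a)
  refine hsum.of_nonneg_of_le (fun r => by positivity) fun r => ?_
  have hden : (0 : ℝ) < r.1.den := by exact_mod_cast r.1.pos
  have hden' : (r.1.den : ℝ) ≤ ‖f r‖ := by simpa [f] using norm_le_pi_norm (f r) 1
  have hnorm : ‖f r‖ ≤ max B 1 * r.1.den := by
    refine (pi_norm_le_iff_of_nonneg (by positivity)).2 (Fin.forall_fin_two.2 ⟨?_, ?_⟩)
    · have hnum : (r.1.num : ℝ) = r.1 * r.1.den := by exact_mod_cast (Rat.mul_den_eq_num r.1).symm
      simp only [f, Matrix.cons_val_zero, Int.norm_eq_abs, hnum, abs_mul, abs_of_pos hden]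
      gcongr
      exact r.2.trans (le_max_left _ _)
    · simpa [f] using le_mul_of_one_le_left hden.le (le_max_right B 1)
  have hpos := hden.trans_le hden'
  have hB : 0 < max B 1 := by positivity
  simp only [Function.comp_apply]
  calc (r.1.den : ℝ) ^ (-a) ≤ (‖f r‖ / max B 1) ^ (-a) :=
        Real.rpow_le_rpow_of_nonpos (by positivity) (by rwa [div_le_iff₀' hB]) (by linarith)
    _ = max B 1 ^ a * ‖f r‖ ^ (-a) := by
        rw [Real.div_rpow hpos.le hB.le, Real.rpow_neg hB.le, div_inv_eq_mul, mul_comm]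

variable {R : Set ℚ} {C τ x : ℝ}

/-- The elements of `R` that approximate `x` to order `τ` with constant `C`. -/
def approximants (R : Set ℚ) (C τ x : ℝ) : Set ℚ :=
  {r | r ∈ R ∧ |x - (r : ℝ)| ≤ C / (r.den : ℝ) ^ τ}

/-- The real numbers that are approximable to order `τ` by elements of `R`, with a constant that may
depend on the number. -/
def approximableBy (R : Set ℚ) (τ : ℝ) : Set ℝ :=
  {x | ∃ C : ℝ, (approximants R C τ x).Infinite}

lemma tendsto_div_den_rpow_cofinite (B C : ℝ) (hτ : 0 < τ) :
    Tendsto (fun r : {r : ℚ // |(r : ℝ)| ≤ B} => C / (r.1.den : ℝ) ^ τ) cofinite (𝓝 0) := by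
  have hcube := (summable_den_rpow_neg B (a := 3) (by norm_num)).tendsto_cofinite_zero
  have hpow := (hcube.rpow_const (p := τ / 3) (.inr (by positivity))).const_mul C
  rw [Real.zero_rpow (by positivity), mul_zero] at hpow
  refine hpow.congr fun r => ?_
  rw [← Real.rpow_mul (by positivity), div_eq_mul_inv C, ← Real.rpow_neg (by positivity)]
  congr 2
  ring

lemma one_le_den_rpow (hτ : 0 ≤ τ) (r : ℚ) : 1 ≤ (r.den : ℝ) ^ τ :=
  Real.one_le_rpow (by exact_mod_cast r.pos) hτ

lemma abs_le_of_mem_approximants (hC : 0 ≤ C) (hτ : 0 ≤ τ) {r : ℚ} (hr : r ∈ approximants R C τ x) :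
    |(r : ℝ)| ≤ |x| + C := by
  have htri := abs_sub_abs_le_abs_sub (r : ℝ) x
  rw [abs_sub_comm] at htri
  linarith [hr.2, div_le_self hC (one_le_den_rpow hτ r)]

lemma mem_limsupBall_iff_infinite_approximants (hC : 0 < C) (hτ : 0 < τ) :
    x ∈ limsupBall (fun r : R => ((r : ℚ) : ℝ)) (fun r : R => C / (r.1.den : ℝ) ^ τ) ↔
      (approximants R C τ x).Infinite := by
  constructor
  · intro hx hfin
    have hsmall : ∀ᶠ ε in 𝓝[>] (0 : ℝ), ∀ r ∈ approximants R C τ x, ε < C / (r.den : ℝ) ^ τ :=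
      (eventually_all_finite hfin).2 fun r _ => nhdsWithin_le_nhds <|
        eventually_lt_nhds (by positivity)
    obtain ⟨ε, hε, hε0⟩ := (hsmall.and self_mem_nhdsWithin).exists
    obtain ⟨r, hr, hxr⟩ := hx ε hε0
    exact (hε r ⟨r.2, hxr⟩).not_gt hr
  · intro hinf ε hε
    have hfin := (tendsto_div_den_rpow_cofinite (|x| + C) C hτ).eventually_lt_const hε
    obtain ⟨r, hr, hrε⟩ :=
      (hinf.sdiff ((eventually_cofinite.1 hfin).image Subtype.val)).nonempty
    refine ⟨⟨r, hr.1⟩, by_contra fun h => hrε ?_, hr.2⟩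
    exact ⟨⟨r, abs_le_of_mem_approximants hC.le hτ.le hr⟩, h, rfl⟩

lemma hausdorffMeasure_infinite_approximants_eq_zero (R : Set ℚ) (hτ : 0 < τ) {d : ℝ}
    (hd : 2 < τ * d) (n : ℕ) :
    μH[d] {x : ℝ | |x| ≤ n ∧ (approximants R n τ x).Infinite} = 0 := by
  have hd0 : 0 < d := pos_of_mul_pos_right (two_pos.trans hd) hτ.le
  let E : {r : ℚ // |(r : ℝ)| ≤ 2 * n} → Set ℝ := fun r => closedBall r (n / (r.1.den : ℝ) ^ τ)
  refine measure_mono_null (fun x hx => ?_)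
    (hausdorffMeasure_setOf_infinite_mem_eq_zero (E := E) hd0 ?_)
  · refine Set.Infinite.of_image Subtype.val (hx.2.mono fun r hr => ?_)
    have hrn := abs_le_of_mem_approximants n.cast_nonneg hτ.le hr
    exact ⟨⟨r, by linarith [hx.1]⟩, hr.2, rfl⟩
  · have hsum := (summable_den_rpow_neg (2 * n) hd).mul_left ((2 * n : ℝ) ^ d)
    refine ne_top_of_le_ne_top hsum.tsum_ofReal_ne_top (ENNReal.tsum_le_tsum fun r => ?_)
    simp only [E]
    rw [Real.closedBall_eq_Icc, Real.ediam_Icc, add_sub_sub_cancel, ← two_mul,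
      ENNReal.ofReal_rpow_of_nonneg (by positivity) hd0.le]
    refine ENNReal.ofReal_le_ofReal (le_of_eq ?_)
    rw [← mul_div_assoc, Real.div_rpow (by positivity) (by positivity),
      ← Real.rpow_mul (Nat.cast_nonneg _), Real.rpow_neg (Nat.cast_nonneg _), div_eq_mul_inv]

lemma dimH_approximableBy_le (R : Set ℚ) (hτ : 0 < τ) :
    dimH (approximableBy R τ) ≤ ENNReal.ofReal (2 / τ) := by
  have hcover : approximableBy R τ ⊆
      ⋃ n : ℕ, {x : ℝ | |x| ≤ n ∧ (approximants R n τ x).Infinite} := by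
    rintro x ⟨C, hC⟩
    obtain ⟨n, hn⟩ := exists_nat_ge (max |x| C)
    refine Set.mem_iUnion.2 ⟨n, (le_max_left _ _).trans hn, hC.mono fun r hr => ⟨hr.1, ?_⟩⟩
    exact hr.2.trans (by gcongr; exact (le_max_right _ _).trans hn)
  refine (dimH_mono hcover).trans ?_
  rw [dimH_iUnion]
  refine iSup_le fun n => le_of_forall_gt_imp_ge_of_dense fun d hd => ?_
  rcases eq_or_ne d ∞ with rfl | hdtop
  · exact le_top
  lift d to NNReal using hdtop
  refine dimH_le_of_hausdorffMeasure_ne_top ?_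
  rw [hausdorffMeasure_infinite_approximants_eq_zero R hτ ?_ n]
  · exact ENNReal.zero_ne_top
  · rw [ENNReal.ofReal_lt_iff_lt_toReal (by positivity) ENNReal.coe_ne_top, ENNReal.coe_toReal,
      div_lt_iff₀' hτ] at hd
    exact hd

lemma hausdorffMeasure_univ_eq_top {s : ℝ} (hs1 : s ≤ 1) : μH[s] (Set.univ : Set ℝ) = ∞ := by
  refine top_unique (le_trans ?_ (Measure.hausdorffMeasure_mono hs1 _))
  rw [hausdorffMeasure_real, Real.volume_univ]

lemma hausdorffMeasure_approximableBy_eq_top (hC : 0 < C) (hτ : 2 ≤ τ)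
    (hR : ∀ᵐ x, (approximants R C 2 x).Infinite) : μH[2 / τ] (approximableBy R τ) = ∞ := by
  have hτ0 : 0 < τ := by linarith
  have hs1 : 2 / τ ≤ 1 := (div_le_one hτ0).2 hτ
  have hpow : ∀ r : R,
      (C ^ (τ / 2) / (r.1.den : ℝ) ^ τ) ^ (2 / τ) = C / (r.1.den : ℝ) ^ (2 : ℝ) := by
    intro r
    rw [Real.div_rpow (by positivity) (by positivity), ← Real.rpow_mul hC.le,
      ← Real.rpow_mul (Nat.cast_nonneg _), mul_div_cancel₀ _ hτ0.ne',
      div_mul_div_cancel₀ two_ne_zero, div_self hτ0.ne', Real.rpow_one]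
  have hMTP := hausdorffMeasure_limsupBall_inter (c := fun r : R => ((r : ℚ) : ℝ))
    (ρ := fun r => C ^ (τ / 2) / (r.1.den : ℝ) ^ τ) (s := 2 / τ)
    (fun r => by positivity) (by positivity) hs1 ?_ isOpen_univ
  · rw [Set.inter_univ, hausdorffMeasure_univ_eq_top hs1] at hMTP
    refine top_unique (hMTP.symm.trans_le (measure_mono fun x hx => ?_))
    exact ⟨_, (mem_limsupBall_iff_infinite_approximants (by positivity) hτ0).1 hx⟩
  · simp only [hpow]
    filter_upwards [hR] with x hx
    exact (mem_limsupBall_iff_infinite_approximants hC two_pos).2 hx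

end Approximation

section Orbit

open OnePoint

lemma moebius_infty (g : SL(2, ℤ)) (hg : g 1 0 ≠ 0) :
    moebius g ∞ = ((g 0 0 / g 1 0 : ℚ) : OnePoint ℚ) := by
  rw [moebius, OnePoint.smul_infty_eq_ite]
  simp [Matrix.SpecialLinearGroup.mapGL, hg]

lemma den_div_eq_natAbs {a b : ℤ} (hb : b ≠ 0) (hab : IsCoprime a b) :
    (a / b : ℚ).den = b.natAbs := by
  rw [← Rat.divInt_eq_div, Rat.den_divInt, if_neg hb, Int.isCoprime_iff_gcd_eq_one.1 hab.symm,
    Nat.div_one]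

lemma exists_cuspEquiv_moebius_mul (Γ : Subgroup SL(2, ℤ)) [Γ.FiniteIndex] (𝔞 : OnePoint ℚ) :
    ∃ K : ℕ, ∀ g : SL(2, ℤ), ∃ h : SL(2, ℤ),
      |h 0 0| ≤ K ∧ |h 1 0| ≤ K ∧ CuspEquiv Γ (moebius (g * h) ∞) 𝔞 := by
  obtain ⟨σ, rfl⟩ := OnePoint.exists_mem_SL2 ℤ 𝔞
  let h : SL(2, ℤ) ⧸ Γ → SL(2, ℤ) := fun a => a.out * σ
  obtain ⟨K, hK⟩ := (Set.finite_range fun a => max |h a 0 0| |h a 1 0|).bddAbove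
  refine ⟨K.toNat, fun g => ⟨h (QuotientGroup.mk g⁻¹), ?_⟩⟩
  have hle := (hK (Set.mem_range_self (QuotientGroup.mk g⁻¹))).trans K.self_le_toNat
  refine ⟨(le_max_left _ _).trans hle, (le_max_right _ _).trans hle, ?_⟩
  have hmem : g * (QuotientGroup.mk g⁻¹ : SL(2, ℤ) ⧸ Γ).out ∈ Γ := by
    simpa using QuotientGroup.eq.1 (QuotientGroup.out_eq' (QuotientGroup.mk g⁻¹)).symm
  refine ⟨_, Γ.inv_mem hmem, ?_⟩
  rw [moebius, moebius, ← mul_smul, ← map_mul]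
  simp only [h]
  group

lemma exists_SL2_col_eq_rat (r : ℚ) (k : ℤ) : ∃ g : SL(2, ℤ), g 0 0 = r.num ∧ g 1 0 = r.den ∧
    k * r.den ≤ g 1 1 ∧ g 1 1 ≤ (k + 1) * r.den := by
  obtain ⟨a, b, hab⟩ : IsCoprime r.num (r.den : ℤ) := Int.isCoprime_iff_gcd_eq_one.2 r.reduced
  have hpos : (0 : ℤ) < r.den := by exact_mod_cast r.pos
  have hmod := Int.emod_add_mul_ediv a r.den
  refine ⟨⟨!![r.num, k * r.num - (b + r.num * (a / r.den)); r.den, k * r.den + a % r.den], ?_⟩,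
    rfl, rfl, le_add_of_nonneg_right (Int.emod_nonneg _ hpos.ne'), ?_⟩
  · rw [Matrix.det_fin_two_of]
    linear_combination r.num * hmod + hab
  · exact (add_le_add_right (Int.emod_lt_of_pos a hpos).le _).trans_eq (by ring)

lemma abs_mul_add_mul_bounds {q d u v K : ℤ} (hq : 0 < q) (huv : IsCoprime u v) (hu : |u| ≤ K)
    (hv : |v| ≤ K) (hd : (K + 1) * q ≤ d) (hd' : d ≤ (K + 1 + 1) * q) :
    q ≤ |q * u + d * v| ∧ |q * u + d * v| ≤ K * (K + 3) * q := by
  have hK : 0 ≤ K := (abs_nonneg u).trans hu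
  have hd0 : 0 ≤ d := le_trans (by positivity) hd
  have hqu : |q * u| ≤ q * K := by
    rw [abs_mul, abs_of_pos hq]
    gcongr
  have hdv : |d * v| = d * |v| := by rw [abs_mul, abs_of_nonneg hd0]
  constructor
  · rcases eq_or_ne v 0 with rfl | hv0
    · have hu1 : |u| = 1 := Int.isUnit_iff_abs_eq.1 (isCoprime_zero_right.1 huv)
      rw [mul_zero, add_zero, abs_mul, hu1, mul_one]
      exact le_abs_self q
    · have hdle : d ≤ |d * v| := hdv ▸ le_mul_of_one_le_right hd0 (Int.one_le_abs hv0)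
      have htri := abs_sub_abs_le_abs_add (d * v) (q * u)
      rw [add_comm (d * v)] at htri
      linarith
  · calc |q * u + d * v| ≤ q * K + d * |v| := (abs_add_le _ _).trans (by rw [hdv]; gcongr)
      _ ≤ q * K + (K + 1 + 1) * q * K := by gcongr
      _ = K * (K + 3) * q := by ring

lemma SL2_mul_apply_zero (g h : SL(2, ℤ)) (i : Fin 2) :
    (g * h) i 0 = g i 0 * h 0 0 + g i 1 * h 1 0 := by
  simp [Matrix.mul_apply, Fin.sum_univ_two]

lemma div_sub_div_SL2_mul (g h : SL(2, ℤ)) (hg : g 1 0 ≠ 0) (hgh : (g * h) 1 0 ≠ 0) :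
    (g 0 0 / g 1 0 : ℝ) - (g * h) 0 0 / (g * h) 1 0 = h 1 0 / (g 1 0 * (g * h) 1 0) := by
  have hdet : g 0 0 * g 1 1 - g 0 1 * g 1 0 = 1 := by rw [← Matrix.det_fin_two, g.det_coe]
  have hnum : g 0 0 * (g * h) 1 0 - g 1 0 * (g * h) 0 0 = h 1 0 := by
    rw [SL2_mul_apply_zero, SL2_mul_apply_zero]
    linear_combination h 1 0 * hdet
  rw [div_sub_div _ _ (by exact_mod_cast hg) (by exact_mod_cast hgh), ← hnum]
  push_cast
  rfl

lemma exists_cuspEquiv_abs_sub_le (Γ : Subgroup SL(2, ℤ)) [Γ.FiniteIndex] (𝔞 : OnePoint ℚ) :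
    ∃ M > (0 : ℝ), ∀ r : ℚ, ∃ r' : ℚ, CuspEquiv Γ r' 𝔞 ∧ r.den ≤ r'.den ∧ r'.den ≤ M * r.den ∧
      |(r : ℝ) - r'| ≤ M / (r.den : ℝ) ^ 2 := by
  obtain ⟨K, hK⟩ := exists_cuspEquiv_moebius_mul Γ 𝔞
  refine ⟨K * (K + 3) + 1, by positivity, fun r => ?_⟩
  have hq : (0 : ℤ) < r.den := by exact_mod_cast r.pos
  -- The size of `g 1 1` keeps the denominator of `g h ∞` comparable with that of `r = g ∞`.
  obtain ⟨g, hg₀, hg₁, hd, hd'⟩ := exists_SL2_col_eq_rat r (K + 1)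
  obtain ⟨h, hu, hv, hequiv⟩ := hK g
  obtain ⟨hle, hle'⟩ := abs_mul_add_mul_bounds hq (h.isCoprime_col 0) hu hv hd hd'
  rw [← hg₁, ← SL2_mul_apply_zero, hg₁] at hle hle'
  have hD : (g * h) 1 0 ≠ 0 := abs_pos.1 (hq.trans_le hle)
  have hdiff := div_sub_div_SL2_mul g h (hg₁ ▸ hq.ne') hD
  have hden : |(g * h) 1 0| = ((((g * h) 0 0 / (g * h) 1 0 : ℚ)).den : ℤ) := by
    rw [den_div_eq_natAbs hD ((g * h).isCoprime_col 0), Int.natCast_natAbs]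
  have hv_le : |(h 1 0 : ℝ)| ≤ K * (K + 3) + 1 := by
    have hvK : |(h 1 0 : ℝ)| ≤ K := by exact_mod_cast hv
    nlinarith [(K.cast_nonneg : (0 : ℝ) ≤ K)]
  have hq_le : (r.den : ℝ) ≤ |((g * h) 1 0 : ℝ)| := by exact_mod_cast hle
  rw [moebius_infty _ hD] at hequiv
  rw [hden] at hle hle'
  refine ⟨_, hequiv, by exact_mod_cast hle, ?_, ?_⟩
  · exact le_trans (by exact_mod_cast hle') (mul_le_mul_of_nonneg_right (lt_add_one _).le
      (Nat.cast_nonneg _))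
  · rw [hg₀, hg₁, Int.cast_natCast, ← Rat.cast_def] at hdiff
    push_cast
    rw [hdiff, abs_div, abs_mul, Nat.abs_cast, sq]
    gcongr

lemma exists_forall_irrational_infinite_approximants (Γ : Subgroup SL(2, ℤ)) [Γ.FiniteIndex]
    (𝔞 : OnePoint ℚ) : ∃ C > 0, ∀ x, Irrational x →
      (approximants {r | CuspEquiv Γ (r : ℚ) 𝔞} C 2 x).Infinite := by
  obtain ⟨M, hM, horbit⟩ := exists_cuspEquiv_abs_sub_le Γ 𝔞
  have hC : 0 < (1 + M) * M ^ 2 := by positivity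
  refine ⟨_, hC, fun x hx => (mem_limsupBall_iff_infinite_approximants hC two_pos).1
    fun ε hε => ?_⟩
  have hdirichlet : (approximants Set.univ 1 2 x).Infinite :=
    (Real.infinite_rat_abs_sub_lt_one_div_den_sq_of_irrational hx).mono
      fun r (hr : |x - r| < 1 / (r.den : ℝ) ^ 2) => ⟨trivial, by simpa using hr.le⟩
  obtain ⟨⟨r, _⟩, hrε, hxr⟩ := (mem_limsupBall_iff_infinite_approximants one_pos two_pos).2
    hdirichlet (ε / ((1 + M) * M ^ 2)) (by positivity)
  obtain ⟨r', hr', hle, hle', hrr'⟩ := horbit r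
  simp only [Real.rpow_two, mem_closedBall, Real.dist_eq] at hrε hxr ⊢
  refine ⟨⟨r', hr'⟩, ?_, ?_⟩
  · calc (1 + M) * M ^ 2 / (r'.den : ℝ) ^ 2 ≤ (1 + M) * M ^ 2 / (r.den : ℝ) ^ 2 := by gcongr
      _ = 1 / (r.den : ℝ) ^ 2 * ((1 + M) * M ^ 2) := by ring
      _ < ε := (lt_div_iff₀ hC).1 hrε
  · calc |x - r'| ≤ |x - r| + |(r : ℝ) - r'| := abs_sub_le _ _ _
      _ ≤ 1 / (r.den : ℝ) ^ 2 + M / (r.den : ℝ) ^ 2 := add_le_add hxr hrr'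
      _ = (1 + M) * M ^ 2 / (M * r.den) ^ 2 := by field_simp
      _ ≤ (1 + M) * M ^ 2 / (r'.den : ℝ) ^ 2 := by gcongr

end Orbit

theorem theorem6p2 (Γ : Subgroup SL(2, ℤ)) (hΓ : Γ.FiniteIndex) (𝔞 : OnePoint ℚ)
    (τ : ℝ) (hτ : 2 ≤ τ) :
    dimH (approxSet Γ 𝔞 τ) = ENNReal.ofReal (2 / τ) ∧
      Measure.hausdorffMeasure (2 / τ) (approxSet Γ 𝔞 τ) = ∞ := by
  have hτ0 : 0 < τ := two_pos.trans_le hτ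
  obtain ⟨C, hC, horbit⟩ := exists_forall_irrational_infinite_approximants Γ 𝔞
  have hirrational : ∀ᵐ x : ℝ, Irrational x := (Set.countable_range ((↑) : ℚ → ℝ)).ae_notMem _
  have htop : μH[2 / τ] (approxSet Γ 𝔞 τ) = ∞ :=
    hausdorffMeasure_approximableBy_eq_top hC hτ (hirrational.mono horbit)
  refine ⟨le_antisymm (dimH_approximableBy_le _ hτ0) ?_, htop⟩
  refine le_dimH_of_hausdorffMeasure_eq_top (d := (2 / τ).toNNReal) ?_
  rwa [Real.coe_toNNReal _ (by positivity)]
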